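/- Let $\mathcal H=\bigoplus_{n\ge 0}\mathcal H_n$ be a connected graded commutative Hopf algebra over $\mathbb C$, let $\mathcal A$ be the algebra of (formal) Laurent series in $\lambda$ over $\mathbb C$, let $G_{\mathcal A}$ be the group of characters (unital algebra morphisms $\mathcal H\to\mathcal A$) under the convolution product $\star$, and let $\mathfrak g_{\mathcal A}$ be the Lie algebra of $\mathcal A$-valued infinitesimal characters, with $[Z,W]=Z\star W-W\star Z$; $\exp:\mathfrak g_{\mathcal A}\to G_{\mathcal A}$ and $\log$ are given by the usual convolution power series, and $d\exp$ at a point $Z$ is the linear map $d\exp(W)=\frac{d}{du}\big|_{u=0}\exp(Z+uW)$. Let $P_+$ and $P_-$ be the projections of $\mathcal A$ onto the holomorphic part $\mathbb C[[\lambda]]$ and the pole part $\lambda^{-1}\mathbb C[\lambda^{-1}]$, and let $R=P_+-P_-$ act on the values of infinitesimal characters. Let $Y(x)=nx$ for $x\in\mathcal H_n$. For $t\in\mathbb C$ and $\varphi\in G_{\mathcal A}$ let $\varphi^t(x)=e^{t\lambda n}\varphi(x)$ for $x\in\mathcal H_n$. The character $\varphi$ is called local if $\frac{d}{dt}(\varphi^t)_-=0$,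 where $\varphi^t=(\varphi^t)_-^{-1}\star(\varphi^t)_+$ is the Birkhoff decomposition: $(\varphi^t)_+$ has values in $\mathbb C[[\lambda]]$ and $(\varphi^t)_-$ maps the kernel of the counit to $\lambda^{-1}\mathbb C[\lambda^{-1}]$. For $\varphi\in G_{\mathcal A}$ set $$\tilde\beta_\varphi=\frac{d}{dt}\Big|_{t=0}\varphi^{-1}\star\varphi^t .$$ Derivatives of curves of linear maps $\mathcal H\to\mathcal A$ are taken at each element of $\mathcal H$, in $\mathcal A=\bigcup_N\lambda^{-N}\mathbb C[[\lambda]]$ with its inductive limit topology (locally bounded pole order and coefficientwise derivative). Let $\varphi\in G_{\mathcal A}$ be local, let $f:\mathfrak g_{\mathcal A}\to\mathfrak g_{\mathcal A}$ be an $\mathrm{Ad}$-covariant map, that is, $g\star f(L)\star g^{-1}=f(g\star L\star g^{-1})$ for all $g\in G_{\mathcal A}$ and $L\in\mathfrak g_{\mathcal A}$, and suppose that $[f(\log\varphi),\log\varphi]=0$. Let $\psi$ be a solution, with values in $\mathfrak g_{\mathcal A}$, on an open interval $I\ni 0$ of the Lax pair equation $$\dot\psi(s)=[\psi(s),M(s)],\qquad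 M(s)=\tfrac12 R(f(\psi(s))),\qquad \psi(0)=\log\varphi,$$ and set $\varphi(s)=\exp\psi(s)$. Then for every $s\in I$ the derivatives defining $\tilde\beta_{\varphi(s)}$ and $d\exp[\log\varphi(s),M(s)]$ (the differential being taken at $\log\varphi(s)$) exist, the curve $s\mapsto\tilde\beta_{\varphi(s)}$ is differentiable at $s$, and $$\frac{d}{ds}\tilde\beta_{\varphi(s)}=\bigl[\tilde\beta_{\varphi(s)},\ \varphi(s)^{-1}\star d\exp[\log\varphi(s),M(s)]\bigr]+\lambda\bigl(\varphi(s)^{-1}\star d\exp[\log\varphi(s),M(s)]\bigr)\circ Y .$$ -/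

import Mathlib

namespace LaxFlow

open scoped TensorProduct
open WithConv

/-- The convolution algebra `Hom(H, A)`: Mathlib's product `(F * G)(h) = ∑ F(h') G(h'')` on `A`-valued
linear maps, with unit the counit. The product is the convolution `⋆`. -/
abbrev ConvAlg (H A : Type*) [CommRing H] [HopfAlgebra ℂ H] [CommRing A] [Algebra ℂ A] : Type _ :=
  WithConv (H →ₗ[ℂ] A)

/-- The group `G_A` of `A`-valued characters of `H` (unital algebra morphisms), under convolution. -/
abbrev CharGroup (H A : Type*) [CommRing H] [HopfAlgebra ℂ H] [CommRing A] [Algebra ℂ A] : Type _ :=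
  WithConv (H →ₐ[ℂ] A)

section Basic

variable {H A : Type*} [CommRing H] [HopfAlgebra ℂ H] [CommRing A] [Algebra ℂ A]

/-- A character regarded as an element of the convolution algebra. -/
def toLin (φ : CharGroup H A) : ConvAlg H A := toConv φ.ofConv.toLinearMap

theorem toLin_mul (φ χ : CharGroup H A) : toLin (φ * χ) = toLin φ * toLin χ := rfl

theorem toLin_one : toLin (1 : CharGroup H A) = 1 := rfl

theorem toLin_pow (φ : CharGroup H A) (n : ℕ) : toLin (φ ^ n) = toLin φ ^ n :=
  AlgHom.toLinearMap_convPow φ n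

/-- Characters form a group under convolution; the inverse is composition with the antipode. -/
noncomputable instance charGroupGroup : Group (CharGroup H A) where
  inv φ := toConv (φ.ofConv.comp (HopfAlgebra.antipodeAlgHom ℂ H))
  inv_mul_cancel φ := by
    apply WithConv.ofConv_injective
    apply AlgHom.toLinearMap_injective
    apply WithConv.toConv_injective
    have h := LinearMap.algHom_comp_convMul_distrib φ.ofConv
      (toConv (HopfAlgebra.antipode ℂ (A := H))) (toConv LinearMap.id)
    rw [LinearMap.antipode_mul_id] at h
    refine (congrArg toConv h).symm.trans ?_
    ext x
    simp

/-- The bracket `[F, G] = F ⋆ G - G ⋆ F`. -/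
noncomputable instance convLieRing : LieRing (ConvAlg H A) := LieRing.ofAssociativeRing

noncomputable instance convLieAlgebra : LieAlgebra ℂ (ConvAlg H A) :=
  LieAlgebra.ofAssociativeAlgebra

/-- `(x ⊗ y) ↦ F x * G y`. -/
noncomputable def box (F G : ConvAlg H A) : WithConv (H ⊗[ℂ] H →ₗ[ℂ] A) :=
  toConv ((Algebra.TensorProduct.lmul' ℂ (S := A)).toLinearMap ∘ₗ
    TensorProduct.map F.ofConv G.ofConv)

theorem box_tmul (F G : ConvAlg H A) (x y : H) : box F G (x ⊗ₜ y) = F x * G y := by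
  simp [box]

theorem box_mul (F G F' G' : ConvAlg H A) : box F G * box F' G' = box (F * F') (G * G') := by
  unfold box
  apply WithConv.ofConv_injective
  have := LinearMap.algHom_comp_convMul_distrib (Algebra.TensorProduct.lmul' ℂ (S := A))
    (toConv (TensorProduct.map F.ofConv G.ofConv)) (toConv (TensorProduct.map F'.ofConv G'.ofConv))
  rw [TensorProduct.map_convMul_map] at this
  exact this.symm

/-- Pull back along the product of `H`. -/
noncomputable def pull (F : ConvAlg H A) : WithConv (H ⊗[ℂ] H →ₗ[ℂ] A) :=
  toConv (F.ofConv ∘ₗ LinearMap.mul' ℂ H)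

theorem pull_tmul (F : ConvAlg H A) (x y : H) : pull F (x ⊗ₜ y) = F (x * y) := by
  simp [pull]

theorem pull_mul (F G : ConvAlg H A) : pull (F * G) = pull F * pull G := by
  apply WithConv.ofConv_injective
  exact LinearMap.convMul_comp_coalgHom_distrib F G (Bialgebra.mulCoalgHom ℂ H)

theorem tensor_ext {P Q : WithConv (H ⊗[ℂ] H →ₗ[ℂ] A)}
    (h : ∀ x y : H, P (x ⊗ₜ y) = Q (x ⊗ₜ y)) : P = Q := by
  apply WithConv.ofConv_injective
  exact TensorProduct.ext' h

theorem pull_one : pull (1 : ConvAlg H A) = 1 :=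
  tensor_ext fun x y => by
    rw [pull_tmul]; simp; exact mul_comm _ _

theorem box_one : box (1 : ConvAlg H A) 1 = 1 :=
  tensor_ext fun x y => by
    rw [box_tmul, LinearMap.convOne_apply, LinearMap.convOne_apply, LinearMap.convOne_apply,
      ← map_mul, TensorProduct.counit_tmul, smul_eq_mul, mul_comm]

theorem pull_toLin (φ : CharGroup H A) : pull (toLin φ) = box (toLin φ) (toLin φ) :=
  tensor_ext fun x y => by
    rw [pull_tmul, box_tmul]; exact map_mul φ.ofConv x y

/-- The Leibniz-type condition defining infinitesimal characters. -/
def IsInf (Z : ConvAlg H A) : Prop :=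
  ∀ x y : H, Z (x * y) = Coalgebra.counit (R := ℂ) y • Z x + Coalgebra.counit (R := ℂ) x • Z y

theorem isInf_iff (Z : ConvAlg H A) : IsInf Z ↔ pull Z = box Z 1 + box 1 Z := by
  have key : ∀ x y : H, (box Z 1 + box 1 Z) (x ⊗ₜ y) =
      Coalgebra.counit (R := ℂ) y • Z x + Coalgebra.counit (R := ℂ) x • Z y := fun x y => by
    show box Z 1 (x ⊗ₜ y) + box 1 Z (x ⊗ₜ y) = _
    rw [box_tmul, box_tmul, LinearMap.convOne_apply, LinearMap.convOne_apply, Algebra.smul_def,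
      Algebra.smul_def, mul_comm]
  constructor
  · intro h
    refine tensor_ext fun x y => ?_
    rw [pull_tmul, key, h]
  · intro h x y
    rw [← pull_tmul, h, key]

theorem IsInf.map_one {Z : ConvAlg H A} (h : IsInf Z) : Z 1 = 0 := by
  have := h 1 1
  simpa using this

theorem isInf_lie {Z W : ConvAlg H A} (hZ : IsInf Z) (hW : IsInf W) : IsInf ⁅Z, W⁆ := by
  have sub1 : ∀ F G K : ConvAlg H A, box (F - G) K = box F K - box G K := fun F G K =>
    tensor_ext fun x y => by
      show _ = box F K (x ⊗ₜ y) - box G K (x ⊗ₜ y)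
      simp only [box_tmul]; exact sub_mul _ _ _
  have sub2 : ∀ F G K : ConvAlg H A, box K (F - G) = box K F - box K G := fun F G K =>
    tensor_ext fun x y => by
      show _ = box K F (x ⊗ₜ y) - box K G (x ⊗ₜ y)
      simp only [box_tmul]; exact mul_sub _ _ _
  have subp : ∀ F G : ConvAlg H A, pull (F - G) = pull F - pull G := fun F G => rfl
  rw [isInf_iff] at *
  rw [Ring.lie_def, subp, pull_mul, pull_mul, hZ, hW, sub1, sub2]
  simp only [mul_add, add_mul, box_mul, one_mul, mul_one]
  abel

theorem isInf_conj (g : CharGroup H A) {Z : ConvAlg H A} (hZ : IsInf Z) :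
    IsInf (toLin g * Z * toLin g⁻¹) := by
  have h1 : toLin g * toLin g⁻¹ = 1 := by rw [← toLin_mul, mul_inv_cancel, toLin_one]
  rw [isInf_iff] at *
  rw [pull_mul, pull_mul, hZ, pull_toLin, pull_toLin]
  simp only [mul_add, add_mul, box_mul, mul_one, h1]

/-- The Lie algebra `𝔤_A` of `A`-valued infinitesimal characters. -/
noncomputable def infChar (H A : Type*) [CommRing H] [HopfAlgebra ℂ H] [CommRing A] [Algebra ℂ A] :
    LieSubalgebra ℂ (ConvAlg H A) where
  carrier := {Z | IsInf Z}
  add_mem' {Z W} hZ hW x y := by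
    show Z (x * y) + W (x * y) = _ • (Z x + W x) + _ • (Z y + W y)
    rw [hZ, hW, smul_add, smul_add]; abel
  zero_mem' x y := by
    show (0 : A) = _ • (0 : A) + _ • (0 : A)
    simp
  smul_mem' c Z hZ x y := by
    show c • Z (x * y) = _ • (c • Z x) + _ • (c • Z y)
    rw [hZ, smul_add, smul_comm c, smul_comm c]
  lie_mem' := isInf_lie

/-- The adjoint action `Ad(g) Z = g ⋆ Z ⋆ g⁻¹` of `G_A` on `𝔤_A`. -/
noncomputable def Ad (g : CharGroup H A) (Z : infChar H A) : infChar H A :=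
  ⟨toLin g * (Z : ConvAlg H A) * toLin g⁻¹, isInf_conj g Z.2⟩

end Basic

section Graded

variable {H : Type*} [CommRing H] [HopfAlgebra ℂ H]

/-- The grading `𝒜` (a grading of the algebra `H` by `GradedAlgebra 𝒜`) makes `H` a connected graded
Hopf algebra: `H_0 = ℂ · 1`, and the counit and the coproduct preserve degrees. (The antipode then
preserves degrees automatically.) -/
class ConnectedGraded (𝒜 : ℕ → Submodule ℂ H) : Prop where
  zero : 𝒜 0 = 1
  counit : ∀ n, n ≠ 0 → ∀ x ∈ 𝒜 n, Coalgebra.counit (R := ℂ) x = 0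
  comul : ∀ n, ∀ x ∈ 𝒜 n, Coalgebra.comul (R := ℂ) x ∈
    ⨆ p ∈ Finset.HasAntidiagonal.antidiagonal n,
      LinearMap.range (TensorProduct.mapIncl (𝒜 p.1) (𝒜 p.2))

variable {A : Type*} [CommRing A] [Algebra ℂ A]

theorem pow_apply_eq_zero (𝒜 : ℕ → Submodule ℂ H) [ConnectedGraded 𝒜]
    {Z : ConvAlg H A} (hZ : Z 1 = 0) (k : ℕ) :
    ∀ n < k, ∀ x ∈ 𝒜 n, (Z ^ k) x = 0 := by
  induction k with
  | zero => intro n hn; omega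
  | succ k ih =>
    intro n hn x hx
    rw [pow_succ', LinearMap.convMul_apply]
    refine Submodule.iSup_induction'
      (motive := fun t _ =>
        LinearMap.mul' ℂ A (TensorProduct.map Z.ofConv (Z ^ k).ofConv t) = 0)
      _ ?_ ?_ ?_ (ConnectedGraded.comul n x hx)
    · intro p t ht
      by_cases hp : p ∈ Finset.HasAntidiagonal.antidiagonal n
      · simp only [hp, iSup_pos] at ht
        obtain ⟨u, rfl⟩ := ht
        have hp' := Finset.HasAntidiagonal.mem_antidiagonal.1 hp
        induction u with
        | zero => simp
        | add a b ha hb => simp only [map_add, ha, hb, add_zero]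
        | tmul a b =>
          simp only [TensorProduct.mapIncl, TensorProduct.map_tmul, Submodule.subtype_apply,
            LinearMap.mul'_apply]
          by_cases h0 : p.1 = 0
          · have : (a : H) ∈ (1 : Submodule ℂ H) := by
              rw [← ConnectedGraded.zero (𝒜 := 𝒜), ← h0]; exact a.2
            obtain ⟨c, hc⟩ := Submodule.mem_one.1 this
            have : Z (a : H) = 0 := by
              rw [← hc, Algebra.algebraMap_eq_smul_one, map_smul, hZ, smul_zero]
            rw [this, zero_mul]
          · rw [ih p.2 (by omega) b b.2, mul_zero]
      · simp only [hp, not_false_eq_true, iSup_neg] at ht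
        rw [(Submodule.mem_bot ℂ).1 ht, map_zero, map_zero]
    · simp
    · intro a b _ _ ha hb
      simp only [map_add, ha, hb, add_zero]

/-- `Z^{⋆ k}(x)` vanishes for all large `k`. -/
theorem exists_bound (𝒜 : ℕ → Submodule ℂ H) [GradedAlgebra 𝒜] [ConnectedGraded 𝒜]
    (x : H) : ∃ N : ℕ, ∀ (Z : ConvAlg H A), Z 1 = 0 → ∀ k, N ≤ k → (Z ^ k) x = 0 := by
  induction x using DirectSum.Decomposition.inductionOn 𝒜 with
  | zero => exact ⟨0, fun Z _ k _ => map_zero _⟩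
  | @homogeneous i m =>
    exact ⟨i + 1, fun Z hZ k hk => pow_apply_eq_zero 𝒜 hZ k i (by omega) m m.2⟩
  | add a b ha hb =>
    obtain ⟨M, hM⟩ := ha
    obtain ⟨N, hN⟩ := hb
    exact ⟨max M N, fun Z hZ k hk => by
      rw [map_add, hM Z hZ k (le_trans (le_max_left _ _) hk),
        hN Z hZ k (le_trans (le_max_right _ _) hk), add_zero]⟩

theorem series_eq_sum (a : ℕ → ℂ) (Z : ConvAlg H A) (x : H) (N : ℕ)
    (h : ∀ k, N ≤ k → (Z ^ k) x = 0) :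
    ∑ᶠ k, a k • (Z ^ k) x = ∑ k ∈ Finset.range N, a k • (Z ^ k) x := by
  refine finsum_eq_sum_of_support_subset _ fun k hk => ?_
  rw [Finset.coe_range, Set.mem_Iio]
  by_contra hlt
  exact hk (by simp only [h k (not_lt.1 hlt), smul_zero])

/-- For `Z(1) = 0`, the series `∑ a_k Z^{⋆ k}`; it is a finite sum at each element of `H`. -/
noncomputable def convSeries (𝒜 : ℕ → Submodule ℂ H) [GradedAlgebra 𝒜] [ConnectedGraded 𝒜]
    (a : ℕ → ℂ) (Z : ConvAlg H A) (hZ : Z 1 = 0) : ConvAlg H A :=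
  toConv
    { toFun := fun x => ∑ᶠ k, a k • (Z ^ k) x
      map_add' := fun x y => by
        obtain ⟨M, hM⟩ := exists_bound (A := A) 𝒜 x
        obtain ⟨N, hN⟩ := exists_bound (A := A) 𝒜 y
        have hM' : ∀ k, max M N ≤ k → (Z ^ k) x = 0 := fun k hk =>
          hM Z hZ k (le_trans (le_max_left _ _) hk)
        have hN' : ∀ k, max M N ≤ k → (Z ^ k) y = 0 := fun k hk =>
          hN Z hZ k (le_trans (le_max_right _ _) hk)
        rw [series_eq_sum a Z x _ hM', series_eq_sum a Z y _ hN',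
          series_eq_sum a Z (x + y) (max M N) fun k hk => by
            rw [map_add, hM' k hk, hN' k hk, add_zero], ← Finset.sum_add_distrib]
        simp only [map_add, smul_add]
      map_smul' := fun c x => by
        obtain ⟨M, hM⟩ := exists_bound (A := A) 𝒜 x
        rw [series_eq_sum a Z x _ (hM Z hZ), series_eq_sum a Z (c • x) M fun k hk => by
            rw [map_smul, hM Z hZ k hk, smul_zero], Finset.smul_sum]
        simp only [map_smul, smul_comm c, RingHom.id_apply] }

/-- Auxiliary polynomial with coefficients the terms of a convolution series. -/
theorem exists_poly (𝒜 : ℕ → Submodule ℂ H) [GradedAlgebra 𝒜] [ConnectedGraded 𝒜]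
    (a : ℕ → ℂ) (Z : ConvAlg H A) (hZ : Z 1 = 0) (x : H) :
    ∃ P : Polynomial A, (∀ k, P.coeff k = a k • (Z ^ k) x) ∧
      P.eval 1 = convSeries 𝒜 a Z hZ x := by
  obtain ⟨N, hN⟩ := exists_bound (A := A) 𝒜 x
  refine ⟨∑ k ∈ Finset.range N, Polynomial.monomial k (a k • (Z ^ k) x), fun k => ?_, ?_⟩
  · simp only [Polynomial.finsetSum_coeff, Polynomial.coeff_monomial, Finset.sum_ite_eq',
      Finset.mem_range]
    split_ifs with h
    · rfl
    · rw [hN Z hZ k (not_lt.1 h), smul_zero]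
  · refine Eq.trans ?_ (series_eq_sum a Z x N (hN Z hZ)).symm
    simp [Polynomial.eval_finsetSum]

theorem IsInf.pow_mul {Z : ConvAlg H A} (hZ : IsInf Z) (n : ℕ) (x y : H) :
    (Z ^ n) (x * y) =
      ∑ p ∈ Finset.HasAntidiagonal.antidiagonal n, n.choose p.1 • ((Z ^ p.1) x * (Z ^ p.2) y) := by
  have hp : ∀ n, pull (Z ^ n) = (pull Z) ^ n := by
    intro n
    induction n with
    | zero => rw [pow_zero, pow_zero, pull_one]
    | succ n ih => rw [pow_succ, pull_mul, ih, pow_succ]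
  have b1 : ∀ n, (box Z (1 : ConvAlg H A)) ^ n = box (Z ^ n) 1 := by
    intro n
    induction n with
    | zero => rw [pow_zero, pow_zero, box_one]
    | succ n ih => rw [pow_succ, ih, box_mul, mul_one, pow_succ]
  have b2 : ∀ n, (box (1 : ConvAlg H A) Z) ^ n = box 1 (Z ^ n) := by
    intro n
    induction n with
    | zero => rw [pow_zero, pow_zero, box_one]
    | succ n ih => rw [pow_succ, ih, box_mul, mul_one, pow_succ]
  have hc : Commute (box Z (1 : ConvAlg H A)) (box 1 Z) := by
    rw [Commute, SemiconjBy, box_mul, box_mul, one_mul, mul_one]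
  rw [← pull_tmul, hp, (isInf_iff Z).1 hZ, hc.add_pow']
  simp only [b1, b2, box_mul, one_mul, mul_one]
  have : ∀ (s : Finset (ℕ × ℕ)) (f : ℕ × ℕ → WithConv (H ⊗[ℂ] H →ₗ[ℂ] A)) (t : H ⊗[ℂ] H),
      (∑ p ∈ s, f p) t = ∑ p ∈ s, f p t := by
    intro s f t
    rw [WithConv.ofConv_sum, LinearMap.sum_apply]
  rw [this]
  refine Finset.sum_congr rfl fun p _ => ?_
  rw [← box_tmul]; rfl

/-- The exponential `exp : 𝔤_A → G_A`, `exp Z = ∑ Z^{⋆ n} / n!`. -/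
noncomputable def charExp (𝒜 : ℕ → Submodule ℂ H) [GradedAlgebra 𝒜] [ConnectedGraded 𝒜]
    (Z : infChar H A) : CharGroup H A :=
  toConv (AlgHom.ofLinearMap
    (convSeries 𝒜 (fun n => (n.factorial : ℂ)⁻¹) (Z : ConvAlg H A) (IsInf.map_one Z.2)).ofConv
    (by
      have h1 : ∀ k, 1 ≤ k → ((Z : ConvAlg H A) ^ k) 1 = 0 := fun k hk =>
        pow_apply_eq_zero 𝒜 (IsInf.map_one Z.2) k 0 hk 1 SetLike.GradedOne.one_mem
      refine (series_eq_sum _ _ _ 1 h1).trans ?_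
      simp)
    (fun x y => by
      obtain ⟨P, hP, hP1⟩ := exists_poly 𝒜 (fun n => (n.factorial : ℂ)⁻¹) (Z : ConvAlg H A)
        (IsInf.map_one Z.2) x
      obtain ⟨Q, hQ, hQ1⟩ := exists_poly 𝒜 (fun n => (n.factorial : ℂ)⁻¹) (Z : ConvAlg H A)
        (IsInf.map_one Z.2) y
      obtain ⟨S, hS, hS1⟩ := exists_poly 𝒜 (fun n => (n.factorial : ℂ)⁻¹) (Z : ConvAlg H A)
        (IsInf.map_one Z.2) (x * y)
      rw [← hP1, ← hQ1, ← hS1, ← Polynomial.eval_mul]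
      congr 1
      ext n
      rw [hS, Polynomial.coeff_mul, IsInf.pow_mul Z.2, Finset.smul_sum]
      refine Finset.sum_congr rfl fun p hp => ?_
      rw [hP, hQ, smul_mul_smul_comm, ← Nat.cast_smul_eq_nsmul ℂ, smul_smul]
      congr 1
      obtain rfl := Finset.HasAntidiagonal.mem_antidiagonal.1 hp
      rw [Nat.cast_choose ℂ (Nat.le_add_right _ _), Nat.add_sub_cancel_left]
      have := Nat.factorial_ne_zero (p.1 + p.2)
      field_simp))


/-- The polynomial interpolating the convolution powers of a character; its linear coefficient is
the logarithm. -/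
theorem exists_log_poly (𝒜 : ℕ → Submodule ℂ H) [GradedAlgebra 𝒜] [ConnectedGraded 𝒜]
    (φ : CharGroup H A) (hφ : (toLin φ - 1) 1 = 0) (x : H) :
    ∃ P : Polynomial A, (∀ m : ℕ, P.eval (m : A) = (φ ^ m) x) ∧
      P.coeff 1 = convSeries 𝒜 (fun n => (-1) ^ (n + 1) / (n : ℂ)) (toLin φ - 1) hφ x := by
  obtain ⟨N, hN⟩ := exists_bound (A := A) 𝒜 x
  have hN' := hN (toLin φ - 1) hφ
  refine ⟨∑ k ∈ Finset.range N, ((descPochhammer ℂ k).map (algebraMap ℂ A)) *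
    Polynomial.C ((k.factorial : ℂ)⁻¹ • ((toLin φ - 1) ^ k) x), fun m => ?_, ?_⟩
  · have h1 : (φ ^ m) x = (toLin φ ^ m) x := by rw [← toLin_pow]; rfl
    have h2 : (toLin φ ^ m) = ∑ k ∈ Finset.range (m + 1), m.choose k • (toLin φ - 1) ^ k := by
      conv_lhs => rw [← sub_add_cancel (toLin φ) 1]
      rw [(Commute.one_right (toLin φ - 1)).add_pow]
      refine Finset.sum_congr rfl fun k _ => ?_
      rw [one_pow, mul_one, nsmul_eq_mul, Nat.cast_comm]
    have h3 : ∀ (s : Finset ℕ) (f : ℕ → ConvAlg H A), (∑ p ∈ s, f p) x = ∑ p ∈ s, f p x := by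
      intro s f
      rw [WithConv.ofConv_sum, LinearMap.sum_apply]
    rw [h1, h2, h3, Polynomial.eval_finsetSum]
    have h4 : ∀ k, Polynomial.eval (m : A) ((descPochhammer ℂ k).map (algebraMap ℂ A) *
        Polynomial.C ((k.factorial : ℂ)⁻¹ • ((toLin φ - 1) ^ k) x)) =
        (m.choose k • (toLin φ - 1) ^ k) x := by
      intro k
      have h5 : Polynomial.eval (m : A) ((descPochhammer ℂ k).map (algebraMap ℂ A)) =
          algebraMap ℂ A ((m.descFactorial k : ℕ) : ℂ) := by
        rw [← descPochhammer_eval_eq_descFactorial, ← map_natCast (algebraMap ℂ A) m,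
          Polynomial.eval_map_apply]
      rw [Polynomial.eval_mul, Polynomial.eval_C, h5, ← Algebra.smul_def, smul_smul,
        Nat.descFactorial_eq_factorial_mul_choose, Nat.cast_mul]
      have : (k.factorial : ℂ) ≠ 0 := Nat.cast_ne_zero.2 k.factorial_ne_zero
      rw [mul_comm (k.factorial : ℂ), mul_assoc, mul_inv_cancel₀ this, mul_one,
        Nat.cast_smul_eq_nsmul]
      rfl
    simp only [h4]
    have e1 : ∀ k, N ≤ k → (m.choose k • (toLin φ - 1) ^ k) x = 0 := fun k hk => by
      show m.choose k • ((toLin φ - 1) ^ k) x = 0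
      rw [hN' k hk, smul_zero]
    have e2 : ∀ k, m + 1 ≤ k → (m.choose k • (toLin φ - 1) ^ k) x = 0 := fun k hk => by
      rw [Nat.choose_eq_zero_of_lt hk, zero_smul]; rfl
    rcases le_total N (m + 1) with h | h
    · refine Finset.sum_subset (Finset.range_mono h) fun k _ hk => e1 k ?_
      simpa using hk
    · refine (Finset.sum_subset (Finset.range_mono h) fun k _ hk => e2 k ?_).symm
      simpa using hk
  · refine Eq.trans ?_ (series_eq_sum _ _ x N hN').symm
    rw [Polynomial.finsetSum_coeff]
    refine Finset.sum_congr rfl fun k _ => ?_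
    rw [Polynomial.coeff_mul_C, Polynomial.coeff_map, ← Algebra.smul_def, smul_smul]
    congr 1
    have ev : ∀ n : ℕ, (descPochhammer ℂ n).eval (-1) = (-1) ^ n * n.factorial := by
      intro n
      induction n with
      | zero => simp
      | succ n ih =>
        rw [descPochhammer_succ_eval, ih, Nat.factorial_succ]
        push_cast
        ring
    cases k with
    | zero => simp [Polynomial.coeff_one]
    | succ k =>
      have : (descPochhammer ℂ (k + 1)).coeff 1 = (-1) ^ k * k.factorial := by
        rw [descPochhammer_succ_left, Polynomial.coeff_X_mul, Polynomial.coeff_zero_eq_eval_zero,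
          Polynomial.eval_comp]
        simp [ev]
      rw [this, Nat.factorial_succ]
      have h1 : (k.factorial : ℂ) ≠ 0 := Nat.cast_ne_zero.2 k.factorial_ne_zero
      have h2 : ((k : ℂ) + 1) ≠ 0 := Nat.cast_add_one_ne_zero k
      push_cast
      field_simp
      ring

theorem toLin_sub_one_apply_one (φ : CharGroup H A) : (toLin φ - 1) 1 = 0 := by
  show φ.ofConv 1 - (1 : ConvAlg H A) 1 = 0
  rw [map_one, LinearMap.convOne_apply, Bialgebra.counit_one, map_one, sub_self]

/-- The logarithm `log : G_A → 𝔤_A`, `log φ = ∑_{n ≥ 1} (-1)^{n+1} (φ - ε)^{⋆ n} / n`.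
The term `n = 0` of the series below vanishes, as division by `0` gives `0`. -/
noncomputable def charLog [IsDomain A] (𝒜 : ℕ → Submodule ℂ H) [GradedAlgebra 𝒜]
    [ConnectedGraded 𝒜] (φ : CharGroup H A) : infChar H A :=
  ⟨convSeries 𝒜 (fun n => (-1) ^ (n + 1) / (n : ℂ)) (toLin φ - 1) (toLin_sub_one_apply_one φ),
    fun x y => by
      obtain ⟨P, hP, hP1⟩ := exists_log_poly 𝒜 φ (toLin_sub_one_apply_one φ) x
      obtain ⟨Q, hQ, hQ1⟩ := exists_log_poly 𝒜 φ (toLin_sub_one_apply_one φ) y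
      obtain ⟨S, hS, hS1⟩ := exists_log_poly 𝒜 φ (toLin_sub_one_apply_one φ) (x * y)
      rw [← hP1, ← hQ1, ← hS1]
      have hinj : Function.Injective (fun m : ℕ => (m : A)) := fun m n h => by
        have h' : algebraMap ℂ A (m : ℂ) = algebraMap ℂ A (n : ℂ) := by
          rw [map_natCast, map_natCast]; exact h
        exact Nat.cast_injective ((algebraMap ℂ A).injective h')
      have hSPQ : S = P * Q := by
        refine Polynomial.eq_of_infinite_eval_eq _ _ ((Set.infinite_range_of_injective hinj).mono ?_)
        rintro _ ⟨m, rfl⟩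
        show S.eval (m : A) = (P * Q).eval (m : A)
        rw [Polynomial.eval_mul, hS, hP, hQ]
        exact map_mul (φ ^ m).ofConv x y
      have h0 : ∀ (R : Polynomial A) (z : H), (∀ m : ℕ, R.eval (m : A) = (φ ^ m) z) →
          R.coeff 0 = algebraMap ℂ A (Coalgebra.counit z) := fun R z hR => by
        have := hR 0
        rw [Nat.cast_zero, pow_zero] at this
        rw [Polynomial.coeff_zero_eq_eval_zero, this]; rfl
      rw [hSPQ, Polynomial.mul_coeff_one, h0 P x hP, h0 Q y hQ, Algebra.smul_def, Algebra.smul_def]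
      ring⟩

/-- The biderivation `Y`, with `Y x = n x` for `x` of degree `n`. -/
noncomputable def degMap (𝒜 : ℕ → Submodule ℂ H) [GradedAlgebra 𝒜] : H →ₗ[ℂ] H :=
  DirectSum.toModule ℂ ℕ H (fun n => (n : ℂ) • (𝒜 n).subtype) ∘ₗ
    (DirectSum.decomposeLinearEquiv 𝒜).toLinearMap

theorem degMap_apply (𝒜 : ℕ → Submodule ℂ H) [GradedAlgebra 𝒜] (n : ℕ) (x : H) (hx : x ∈ 𝒜 n) :
    degMap 𝒜 x = (n : ℂ) • x := by
  lift x to 𝒜 n using hx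
  simp [degMap]
/-- `F ∘ Y`. -/
noncomputable def compDeg (𝒜 : ℕ → Submodule ℂ H) [GradedAlgebra 𝒜] (F : ConvAlg H A) :
    ConvAlg H A :=
  toConv (F.ofConv ∘ₗ degMap 𝒜)

/-- Multiplication of the values of `F` by `a`: the map `h ↦ a * F(h)`. -/
noncomputable def mulValue (a : A) (F : ConvAlg H A) : ConvAlg H A :=
  toConv (LinearMap.mulLeft ℂ a ∘ₗ F.ofConv)

/-- `ℂ`-linear endomorphisms of the target algebra. -/
abbrev LinEnd (A : Type*) [CommRing A] [Algebra ℂ A] : Type _ := A →ₗ[ℂ] A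

/-- `T ∘ Z` for an infinitesimal character `Z` and a `ℂ`-linear endomorphism `T` of `A`. -/
noncomputable def compLinEnd (T : LinEnd A) (Z : infChar H A) : infChar H A :=
  ⟨toConv (T ∘ₗ (Z : ConvAlg H A).ofConv), fun x y => by
    show T ((Z : ConvAlg H A) (x * y)) =
      _ • T ((Z : ConvAlg H A) x) + _ • T ((Z : ConvAlg H A) y)
    rw [Z.2 x y, map_add, map_smul, map_smul]⟩

/-- The linear map with `x ↦ e n * φ x` for `x` of degree `n`. -/
noncomputable def rescaleLin (𝒜 : ℕ → Submodule ℂ H) [GradedAlgebra 𝒜] (φ : CharGroup H A)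
    (e : ℕ → A) : H →ₗ[ℂ] A :=
  DirectSum.toModule ℂ ℕ A
      (fun n => LinearMap.mulLeft ℂ (e n) ∘ₗ φ.ofConv.toLinearMap ∘ₗ (𝒜 n).subtype) ∘ₗ
    (DirectSum.decomposeLinearEquiv 𝒜).toLinearMap

theorem rescaleLin_apply (𝒜 : ℕ → Submodule ℂ H) [GradedAlgebra 𝒜] (φ : CharGroup H A)
    (e : ℕ → A) (n : ℕ) (x : H) (hx : x ∈ 𝒜 n) :
    rescaleLin 𝒜 φ e x = e n * φ x := by
  lift x to 𝒜 n using hx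
  simp [rescaleLin]

/-- The character with `x ↦ e n * φ x` for `x` of degree `n`, where `e` is multiplicative. -/
noncomputable def rescaleChar (𝒜 : ℕ → Submodule ℂ H) [GradedAlgebra 𝒜] (φ : CharGroup H A)
    (e : ℕ → A) (e0 : e 0 = 1) (emul : ∀ i j, e (i + j) = e i * e j) : CharGroup H A :=
  toConv (AlgHom.ofLinearMap (rescaleLin 𝒜 φ e)
    (by
      rw [rescaleLin_apply 𝒜 φ e 0 1 SetLike.GradedOne.one_mem, e0, one_mul]
      exact map_one φ.ofConv)
    (fun x y => by
      induction x using DirectSum.Decomposition.inductionOn 𝒜 with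
      | zero => simp
      | add a b ha hb => rw [add_mul, map_add, map_add, ha, hb, add_mul]
      | @homogeneous i m =>
        induction y using DirectSum.Decomposition.inductionOn 𝒜 with
        | zero => simp
        | add a b ha hb => rw [mul_add, map_add, map_add, ha, hb, mul_add]
        | @homogeneous j k =>
          rw [rescaleLin_apply 𝒜 φ e _ _ (SetLike.GradedMul.mul_mem m.2 k.2),
            rescaleLin_apply 𝒜 φ e i m m.2, rescaleLin_apply 𝒜 φ e j k k.2, emul]
          have : φ ((m : H) * k) = φ m * φ k := map_mul φ.ofConv _ _
          rw [this]
          ring))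

end Graded

section LaurentValues

/-- The algebra of formal Laurent series over `ℂ` in the variable `λ`. -/
def Laurent : Type := LaurentSeries ℂ

noncomputable instance : Field Laurent := inferInstanceAs (Field (LaurentSeries ℂ))

noncomputable instance : Algebra ℂ Laurent :=
  (HahnSeries.instAlgebra : Algebra ℂ (HahnSeries ℤ ℂ))

/-- The coefficient of `λ^n`. -/
def Laurent.coeff (a : Laurent) (n : ℤ) : ℂ := HahnSeries.coeff a n

theorem Laurent.ext {a b : Laurent} (h : ∀ n, a.coeff n = b.coeff n) : a = b :=
  HahnSeries.ext (funext h)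

theorem Laurent.coeff_add (a b : Laurent) (n : ℤ) : (a + b).coeff n = a.coeff n + b.coeff n := rfl

theorem Laurent.coeff_smul (c : ℂ) (a : Laurent) (n : ℤ) : (c • a).coeff n = c * a.coeff n := rfl

theorem Laurent.coeff_one (n : ℤ) : (1 : Laurent).coeff n = if n = 0 then 1 else 0 := by
  show HahnSeries.coeff (1 : HahnSeries ℤ ℂ) n = _
  rw [HahnSeries.coeff_one]
  congr

/-- The variable `λ`. -/
noncomputable def lam : Laurent := HahnSeries.single (1 : ℤ) (1 : ℂ)

/-- The series `e^{cλ}`. -/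
noncomputable def expLam (c : ℂ) : Laurent :=
  HahnSeries.ofPowerSeries ℤ ℂ (PowerSeries.rescale c (PowerSeries.exp ℂ))

theorem expLam_add (a b : ℂ) : expLam (a + b) = expLam a * expLam b :=
  (congrArg (HahnSeries.ofPowerSeries ℤ ℂ)
    (PowerSeries.exp_mul_exp_eq_exp_add (A := ℂ) a b).symm).trans (map_mul _ _ _)

theorem expLam_zero : expLam 0 = 1 := by
  have h : PowerSeries.rescale (0 : ℂ) (PowerSeries.exp ℂ) = 1 := by simp
  exact (congrArg (HahnSeries.ofPowerSeries ℤ ℂ) h).trans (map_one _)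

/-- The projection `P_-` onto the pole part `λ⁻¹ ℂ[λ⁻¹]`. -/
noncomputable def polePart : LinEnd Laurent where
  toFun a := HahnSeries.truncLT (0 : ℤ) (a : LaurentSeries ℂ)
  map_add' a b := HahnSeries.truncLT_add (0 : ℤ) (a : LaurentSeries ℂ) b
  map_smul' c a := HahnSeries.truncLT_smul (0 : ℤ) c (a : LaurentSeries ℂ)

theorem polePart_coeff (a : Laurent) (n : ℤ) :
    (polePart a).coeff n = if n < 0 then a.coeff n else 0 :=
  HahnSeries.coeff_truncLT (0 : ℤ) (a : LaurentSeries ℂ) n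

/-- The projection `P_+` onto the holomorphic part `ℂ[[λ]]`. -/
noncomputable def holPart : LinEnd Laurent := LinearMap.id - polePart

/-- A curve of Laurent series has derivative `f'` at `t`, in the inductive limit topology of
`⋃ λ^{-N} ℂ[[λ]]`: the pole orders are bounded near `t` and each coefficient is differentiable. -/
structure HasLaurentDerivAt {𝕜 : Type*} [NontriviallyNormedField 𝕜] [NormedAlgebra 𝕜 ℂ]
    (f : 𝕜 → Laurent) (f' : Laurent) (t : 𝕜) : Prop where
  bounded : ∃ N : ℤ, ∀ᶠ u in nhds t, ∀ n, n < N → (f u).coeff n = 0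
  coeff : ∀ n : ℤ, HasDerivAt (fun u => (f u).coeff n) (f'.coeff n) t

variable {H : Type*} [CommRing H] [HopfAlgebra ℂ H]

/-- Derivative of a curve of Laurent-valued linear maps, evaluated on each element of `H`. -/
def HasConvDerivAt {𝕜 : Type*} [NontriviallyNormedField 𝕜] [NormedAlgebra 𝕜 ℂ]
    (F : 𝕜 → ConvAlg H Laurent) (F' : ConvAlg H Laurent) (t : 𝕜) : Prop :=
  ∀ x : H, HasLaurentDerivAt (fun u => F u x) (F' x) t

theorem HasConvDerivAt.unique {𝕜 : Type*} [NontriviallyNormedField 𝕜] [NormedAlgebra 𝕜 ℂ]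
    {F : 𝕜 → ConvAlg H Laurent} {F₁ F₂ : ConvAlg H Laurent} {t : 𝕜}
    (h₁ : HasConvDerivAt F F₁ t) (h₂ : HasConvDerivAt F F₂ t) : F₁ = F₂ := by
  apply WithConv.ofConv_injective
  refine LinearMap.ext fun x => Laurent.ext fun n => ?_
  exact ((h₁ x).coeff n).unique ((h₂ x).coeff n)

open Classical in
/-- The derivative of a curve of Laurent-valued linear maps (zero if it does not exist). -/
noncomputable def convDeriv {𝕜 : Type*} [NontriviallyNormedField 𝕜] [NormedAlgebra 𝕜 ℂ]
    (F : 𝕜 → ConvAlg H Laurent) (t : 𝕜) : ConvAlg H Laurent :=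
  if h : ∃ F' : ConvAlg H Laurent, HasConvDerivAt F F' t then h.choose else 0

/-- `R = P_+ - P_-`, acting on the values of infinitesimal characters. -/
noncomputable def rMatrix (Z : infChar H Laurent) : infChar H Laurent :=
  compLinEnd (holPart - polePart) Z

/-- The character `φ^t`, with `φ^t(x) = e^{tλ|x|} φ(x)` for homogeneous `x` of degree `|x|`. -/
noncomputable def scaleChar (𝒜 : ℕ → Submodule ℂ H) [GradedAlgebra 𝒜]
    (φ : CharGroup H Laurent) (t : ℂ) : CharGroup H Laurent :=
  rescaleChar 𝒜 φ (fun n => expLam (t * n)) (by simp [expLam_zero])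
    (fun i j => by rw [Nat.cast_add, mul_add, expLam_add])

/-- `φ = φm⁻¹ ⋆ φp` is the Birkhoff decomposition of `φ`: `φp` has holomorphic values, and `φm`
takes values in `λ⁻¹ ℂ[λ⁻¹]` on the augmentation ideal. -/
structure IsBirkhoff (φ φm φp : CharGroup H Laurent) : Prop where
  eq : φ = φm⁻¹ * φp
  pole : ∀ x : H, Coalgebra.counit (R := ℂ) x = 0 → ∀ n : ℤ, 0 ≤ n → (φm x).coeff n = 0
  hol : ∀ x : H, ∀ n : ℤ, n < 0 → (φp x).coeff n = 0

/-- Local characters: `d/dt (φ^t)_- = 0`, where `(φ^t)_-` is the negative part of the Birkhoff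
decomposition of `φ^t`. -/
def IsLocal (𝒜 : ℕ → Submodule ℂ H) [GradedAlgebra 𝒜] (φ : CharGroup H Laurent) : Prop :=
  ∃ φm φp : ℂ → CharGroup H Laurent,
    (∀ t, IsBirkhoff (scaleChar 𝒜 φ t) (φm t) (φp t)) ∧
      ∀ t, HasConvDerivAt (fun u => toLin (φm u)) 0 t

/-- The curve `t ↦ φ⁻¹ ⋆ φ^t`. -/
noncomputable def betaCurve (𝒜 : ℕ → Submodule ℂ H) [GradedAlgebra 𝒜]
    (φ : CharGroup H Laurent) (t : ℂ) : ConvAlg H Laurent :=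
  toLin (φ⁻¹ * scaleChar 𝒜 φ t)

/-- The beta character: the derivative of `φ⁻¹ ⋆ φ^t` at `t = 0`. -/
noncomputable def betaChar (𝒜 : ℕ → Submodule ℂ H) [GradedAlgebra 𝒜]
    (φ : CharGroup H Laurent) : ConvAlg H Laurent :=
  convDeriv (betaCurve 𝒜 φ) 0

/-- The curve `u ↦ exp (Z + u W)`. -/
noncomputable def expCurve (𝒜 : ℕ → Submodule ℂ H) [GradedAlgebra 𝒜] [ConnectedGraded 𝒜]
    (Z W : infChar H Laurent) (u : ℂ) : ConvAlg H Laurent :=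
  toLin (charExp 𝒜 (Z + u • W))

/-- The differential of `exp` at `Z`, applied to the tangent vector `W`. -/
noncomputable def dexp (𝒜 : ℕ → Submodule ℂ H) [GradedAlgebra 𝒜] [ConnectedGraded 𝒜]
    (Z W : infChar H Laurent) : ConvAlg H Laurent :=
  convDeriv (expCurve 𝒜 Z W) 0

/-- `Ad`-covariant maps of `𝔤_A`. -/
def AdCovariant (f : infChar H Laurent → infChar H Laurent) : Prop :=
  ∀ (g : CharGroup H Laurent) (L : infChar H Laurent), Ad g (f L) = f (Ad g L)

end LaurentValues

end LaxFlow

/-! Since `φ^t` multiplies degree `n` by `e^{tnλ}`, the beta character has the closed form `λ φ⁻¹ ⋆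
(φ ∘ Y)` (`betaChar_eq`): up to the factor `λ` it is the logarithmic derivative of `φ` with respect
to `F ↦ F ∘ Y`. Because `Y` is a coderivation, that operation is a derivation of the convolution
product (`compDeg_mul`).

Let `φ(s)` be a differentiable curve of characters with derivative `D`, and put `X = φ⁻¹ ⋆ D`. The
inverse has derivative `-X ⋆ φ⁻¹`, and `D = φ ⋆ X` gives `D ∘ Y = (φ ∘ Y) ⋆ X + φ ⋆ (X ∘ Y)`.
Differentiating the closed form therefore gives `-X ⋆ β + β ⋆ X + λ X ∘ Y`, where `β` is the beta
character; this is `HasConvDerivAt.betaChar`.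

For the Lax flow, the chain rule `HasConvDerivAt.charExp` gives `D = dexp [ψ, M]` at `ψ(s)`, and
`charLog_charExp` identifies `ψ(s)` with `log φ(s)`. The remaining work is calculus: a Leibniz rule
for Laurent-valued curves, and the fact that convolution series are finite sums at each element of
`H`, with a length independent of the infinitesimal character. -/

namespace LaxFlow

open scoped TensorProduct
open WithConv

/-! ### Differentiation of curves of Laurent series. -/

section LaurentCalculus

/-- If `a` and `b` have no terms below `λ^N` and `λ^M`, the coefficients of `a * b` are sums over
fixed finite intervals. -/
theorem Laurent.coeff_mul {a b : Laurent} {N M : ℤ} (ha : ∀ n < N, a.coeff n = 0)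
    (hb : ∀ n < M, b.coeff n = 0) (n : ℤ) :
    (a * b).coeff n = ∑ i ∈ Finset.Icc N (n - M), a.coeff i * b.coeff (n - i) := by
  refine (HahnSeries.coeff_mul (x := (a : LaurentSeries ℂ)) (y := (b : LaurentSeries ℂ))).trans ?_
  -- The library sum runs over pairs in the supports only, so just the nonzero terms of the two sums
  -- are matched.
  refine Finset.sum_bij_ne_zero (fun ij _ _ => ij.1) ?_ ?_ ?_ ?_
  · intro ij hij h
    have h1 : N ≤ ij.1 := by
      by_contra hlt
      exact h (mul_eq_zero_of_left (ha _ (not_le.1 hlt)) _)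
    have h2 : M ≤ ij.2 := by
      by_contra hlt
      exact h (mul_eq_zero_of_right _ (hb _ (not_le.1 hlt)))
    have h3 : ij.1 + ij.2 = n := (Finset.mem_antidiagonal.1 hij).2.2
    exact Finset.mem_Icc.2 ⟨h1, by omega⟩
  · intro p hp _ q hq _ hpq
    have h3 : p.1 + p.2 = n := (Finset.mem_antidiagonal.1 hp).2.2
    have h4 : q.1 + q.2 = n := (Finset.mem_antidiagonal.1 hq).2.2
    exact Prod.ext hpq (by omega)
  · intro i _ h
    refine ⟨(i, n - i), Finset.mem_antidiagonal.2 ⟨left_ne_zero_of_mul h,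
      right_ne_zero_of_mul h, by simp⟩, h, rfl⟩
  · intro p hp _
    have h3 : p.1 + p.2 = n := (Finset.mem_antidiagonal.1 hp).2.2
    rw [show n - p.1 = p.2 by omega]
    rfl

theorem Laurent.exists_bound_coeff (a : Laurent) : ∃ N : ℤ, ∀ n < N, a.coeff n = 0 :=
  ⟨HahnSeries.order (a : LaurentSeries ℂ), fun _ h => HahnSeries.coeff_eq_zero_of_lt_order h⟩

variable {𝕜 : Type*} [NontriviallyNormedField 𝕜] [NormedAlgebra 𝕜 ℂ]

namespace HasLaurentDerivAt

theorem const (a : Laurent) (t : 𝕜) : HasLaurentDerivAt (fun _ : 𝕜 => a) 0 t where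
  bounded := by
    obtain ⟨N, hN⟩ := a.exists_bound_coeff
    exact ⟨N, Filter.Eventually.of_forall fun _ => hN⟩
  coeff n := hasDerivAt_const t (a.coeff n)

variable {f g : 𝕜 → Laurent} {f' g' : Laurent} {t : 𝕜}

theorem congr_of_eventuallyEq (hf : HasLaurentDerivAt f f' t) (h : g =ᶠ[nhds t] f) :
    HasLaurentDerivAt g f' t where
  bounded := by
    obtain ⟨N, hN⟩ := hf.bounded
    exact ⟨N, by filter_upwards [hN, h] with u hu hgu; rwa [hgu]⟩
  coeff n := (hf.coeff n).congr_of_eventuallyEq (h.fun_comp fun a : Laurent => a.coeff n)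

theorem unique (h₁ : HasLaurentDerivAt f f' t) (h₂ : HasLaurentDerivAt f g' t) : f' = g' :=
  Laurent.ext fun n => (h₁.coeff n).unique (h₂.coeff n)

theorem add (hf : HasLaurentDerivAt f f' t) (hg : HasLaurentDerivAt g g' t) :
    HasLaurentDerivAt (fun u => f u + g u) (f' + g') t where
  bounded := by
    obtain ⟨N, hN⟩ := hf.bounded
    obtain ⟨M, hM⟩ := hg.bounded
    refine ⟨min N M, ?_⟩
    filter_upwards [hN, hM] with u hu hu' n hn
    rw [Laurent.coeff_add, hu n (lt_of_lt_of_le hn (min_le_left _ _)),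
      hu' n (lt_of_lt_of_le hn (min_le_right _ _)), add_zero]
  coeff n := (hf.coeff n).add (hg.coeff n)

theorem sum {ι : Type*} (s : Finset ι) {F : ι → 𝕜 → Laurent} {F' : ι → Laurent}
    (h : ∀ i ∈ s, HasLaurentDerivAt (F i) (F' i) t) :
    HasLaurentDerivAt (fun u => ∑ i ∈ s, F i u) (∑ i ∈ s, F' i) t := by
  classical
  induction s using Finset.induction_on with
  | empty => simpa using const (0 : Laurent) t
  | insert i s hi ih =>
    simp only [Finset.sum_insert hi]
    exact (h i (Finset.mem_insert_self i s)).add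
      (ih fun j hj => h j (Finset.mem_insert_of_mem hj))

/-- A pole bound valid near `t` makes each coefficient of the product a finite sum over an interval
that does not depend on `u`, so the scalar Leibniz rule applies term by term. -/
theorem mul (hf : HasLaurentDerivAt f f' t) (hg : HasLaurentDerivAt g g' t) :
    HasLaurentDerivAt (fun u => f u * g u) (f' * g t + f t * g') t := by
  -- The derivative inherits the pole bound of the curve, so the products containing `f'` or `g'`
  -- expand over the same interval.
  have low : ∀ {k : 𝕜 → Laurent} {k' : Laurent} {N : ℤ}, HasLaurentDerivAt k k' t →
      (∀ᶠ u in nhds t, ∀ n, n < N → (k u).coeff n = 0) → ∀ n < N, k'.coeff n = 0 := by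
    intro k k' N hk hN n hn
    refine (hk.coeff n).unique ((hasDerivAt_const t (0 : ℂ)).congr_of_eventuallyEq ?_)
    filter_upwards [hN] with u hu using hu n hn
  obtain ⟨N, hN⟩ := hf.bounded
  obtain ⟨M, hM⟩ := hg.bounded
  have hmul : ∀ᶠ u in nhds t, ∀ n, (f u * g u).coeff n =
      ∑ i ∈ Finset.Icc N (n - M), (f u).coeff i * (g u).coeff (n - i) := by
    filter_upwards [hN, hM] with u hu hu' n using Laurent.coeff_mul hu hu' n
  refine ⟨⟨N + M, ?_⟩, fun n => ?_⟩
  · filter_upwards [hmul] with u hu n hn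
    rw [hu n, Finset.Icc_eq_empty (by omega), Finset.sum_empty]
  · rw [Laurent.coeff_add, Laurent.coeff_mul (low hf hN) hM.self_of_nhds n,
      Laurent.coeff_mul hN.self_of_nhds (low hg hM) n, ← Finset.sum_add_distrib]
    refine HasDerivAt.congr_of_eventuallyEq ?_ (hmul.mono fun u hu => hu n)
    exact HasDerivAt.fun_sum fun i _ => (hf.coeff i).fun_mul (hg.coeff (n - i))

theorem const_mul (a : Laurent) (hf : HasLaurentDerivAt f f' t) :
    HasLaurentDerivAt (fun u => a * f u) (a * f') t := by
  simpa using (const a t).mul hf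

theorem mul_const (a : Laurent) (hf : HasLaurentDerivAt f f' t) :
    HasLaurentDerivAt (fun u => f u * a) (f' * a) t := by
  simpa using hf.mul (const a t)

theorem const_smul (c : ℂ) (hf : HasLaurentDerivAt f f' t) :
    HasLaurentDerivAt (fun u => c • f u) (c • f') t := by
  simpa only [Algebra.smul_def] using hf.const_mul (algebraMap ℂ Laurent c)

end HasLaurentDerivAt

theorem expLam_coeff_natCast (c : ℂ) (k : ℕ) :
    (expLam c).coeff (k : ℤ) = c ^ k * (k.factorial : ℂ)⁻¹ := by
  refine (HahnSeries.ofPowerSeries_apply_coeff _ k).trans ?_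
  simp [PowerSeries.coeff_rescale, PowerSeries.coeff_exp]

theorem expLam_coeff_of_neg (c : ℂ) {n : ℤ} (hn : n < 0) : (expLam c).coeff n = 0 := by
  refine HahnSeries.embDomain_of_notMem_range ?_
  rintro ⟨k, hk⟩
  have : (k : ℤ) = n := hk
  omega

theorem lam_coeff (n : ℤ) : lam.coeff n = if n = 1 then 1 else 0 := by
  refine (HahnSeries.coeff_single (Γ := ℤ) (a := 1) (b := n) (r := (1 : ℂ))).trans ?_
  congr

/-- The derivative of `t ↦ e^{tcλ}` at `0` is `cλ`. -/
theorem hasLaurentDerivAt_expLam (c : ℂ) :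
    HasLaurentDerivAt (fun t : ℂ => expLam (t * c)) (c • lam) 0 where
  bounded := ⟨0, Filter.Eventually.of_forall fun t n hn => expLam_coeff_of_neg _ hn⟩
  coeff n := by
    rw [Laurent.coeff_smul, lam_coeff]
    rcases lt_or_ge n 0 with hn | hn
    · simp only [expLam_coeff_of_neg _ hn, if_neg (show n ≠ 1 by omega), mul_zero]
      exact hasDerivAt_const _ _
    · lift n to ℕ using hn
      simp only [expLam_coeff_natCast, Nat.cast_eq_one]
      have h := ((((hasDerivAt_id (0 : ℂ)).mul_const c).pow n).mul_const
        ((n.factorial : ℂ)⁻¹))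
      refine h.congr_deriv ?_
      -- The coefficient is `(tc)^n / n!`; its derivative at `0` is nonzero only for `n = 1`, hence
      -- the cases `0`, `1` and at least `2`.
      rcases n with _ | _ | n <;> simp

end LaurentCalculus

/-! ### Convolution power series, and the logarithm as left inverse of the exponential. -/

section ConvSeries

variable {H A : Type*} [CommRing H] [HopfAlgebra ℂ H] [CommRing A] [Algebra ℂ A]

theorem conv_ext {F G : ConvAlg H A} (h : ∀ x : H, F x = G x) : F = G :=
  WithConv.ofConv_injective (LinearMap.ext h)

theorem conv_mul_apply (F G : ConvAlg H A) (x : H) :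
    (F * G) x = box F G (Coalgebra.comul (R := ℂ) x) := rfl

theorem conv_add_apply (F G : ConvAlg H A) (x : H) : (F + G) x = F x + G x := rfl

theorem conv_smul_apply (c : ℂ) (F : ConvAlg H A) (x : H) : (c • F) x = c • F x := rfl

theorem conv_sum_apply {ι : Type*} (s : Finset ι) (F : ι → ConvAlg H A) (x : H) :
    (∑ i ∈ s, F i) x = ∑ i ∈ s, F i x := by
  rw [WithConv.ofConv_sum, LinearMap.sum_apply]

variable (𝒜 : ℕ → Submodule ℂ H) [GradedAlgebra 𝒜] [ConnectedGraded 𝒜]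

/-- At a fixed element, a convolution series is the value of each of its long partial sums. -/
theorem exists_convSeries_eq_aeval_trunc (p : PowerSeries ℂ) (Z : ConvAlg H A) (hZ : Z 1 = 0)
    (x : H) : ∃ N : ℕ, ∀ n, N ≤ n →
      convSeries 𝒜 (fun k => p.coeff k) Z hZ x = Polynomial.aeval Z (p.trunc n) x := by
  obtain ⟨N, hN⟩ := exists_bound (A := A) 𝒜 x
  refine ⟨N, fun n hn => ?_⟩
  refine (series_eq_sum _ Z x n fun k hk => hN Z hZ k (hn.trans hk)).trans ?_
  rw [PowerSeries.trunc_apply, ← Finset.range_eq_Ico, map_sum, conv_sum_apply]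
  refine Finset.sum_congr rfl fun k _ => ?_
  rw [Polynomial.aeval_monomial, ← Algebra.smul_def]
  rfl

/-- Convolution series multiply like formal power series. -/
theorem convSeries_mul (p q : PowerSeries ℂ) (Z : ConvAlg H A) (hZ : Z 1 = 0) :
    convSeries 𝒜 (fun k => (p * q).coeff k) Z hZ =
      convSeries 𝒜 (fun k => p.coeff k) Z hZ * convSeries 𝒜 (fun k => q.coeff k) Z hZ := by
  -- The sufficient truncation order depends on the element, so a common order for all tensor
  -- factors of the coproduct is obtained by induction on tensors.
  have hbox : ∀ t : H ⊗[ℂ] H, ∃ N : ℕ, ∀ n, N ≤ n →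
      box (convSeries 𝒜 (fun k => p.coeff k) Z hZ) (convSeries 𝒜 (fun k => q.coeff k) Z hZ) t =
        box (Polynomial.aeval Z (p.trunc n)) (Polynomial.aeval Z (q.trunc n)) t := by
    intro t
    induction t with
    | zero => exact ⟨0, fun n _ => by rw [map_zero, map_zero]⟩
    | tmul x y =>
      obtain ⟨N, hN⟩ := exists_convSeries_eq_aeval_trunc 𝒜 p Z hZ x
      obtain ⟨M, hM⟩ := exists_convSeries_eq_aeval_trunc 𝒜 q Z hZ y
      refine ⟨max N M, fun n hn => ?_⟩
      rw [box_tmul, box_tmul, hN n ((le_max_left _ _).trans hn),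
        hM n ((le_max_right _ _).trans hn)]
    | add a b ha hb =>
      obtain ⟨N, hN⟩ := ha
      obtain ⟨M, hM⟩ := hb
      refine ⟨max N M, fun n hn => ?_⟩
      rw [map_add, map_add, hN n ((le_max_left _ _).trans hn),
        hM n ((le_max_right _ _).trans hn)]
  refine conv_ext fun x => ?_
  obtain ⟨N, hN⟩ := exists_bound (A := A) 𝒜 x
  obtain ⟨M, hM⟩ := exists_convSeries_eq_aeval_trunc 𝒜 (p * q) Z hZ x
  obtain ⟨K, hK⟩ := hbox (Coalgebra.comul (R := ℂ) x)
  obtain ⟨n, hn⟩ : ∃ n, max N (max M K) ≤ n := ⟨_, le_rfl⟩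
  -- Powers `Z^k` with `k ≥ n ≥ N` kill `x`, so only coefficients below `n` matter at `x`.
  have vanish : ∀ r : Polynomial ℂ, (∀ k < n, r.coeff k = 0) → Polynomial.aeval Z r x = 0 := by
    intro r hr
    rw [Polynomial.aeval_eq_sum_range, conv_sum_apply]
    refine Finset.sum_eq_zero fun k _ => ?_
    rw [conv_smul_apply]
    rcases lt_or_ge k n with h | h
    · rw [hr k h, zero_smul]
    · rw [hN Z hZ k (by omega), smul_zero]
  rw [conv_mul_apply, hM n (by omega), hK n (by omega), ← conv_mul_apply, ← map_mul,
    ← sub_eq_zero]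
  -- The truncated product and the product of truncations differ only in degrees at least `n`.
  have h := vanish ((p * q).trunc n - p.trunc n * q.trunc n) fun k hk => by
    rw [Polynomial.coeff_sub, PowerSeries.coeff_trunc, if_pos hk, sub_eq_zero,
      PowerSeries.coeff_mul, Polynomial.coeff_mul]
    refine Finset.sum_congr rfl fun ij hij => ?_
    have := Finset.HasAntidiagonal.mem_antidiagonal.1 hij
    rw [PowerSeries.coeff_trunc, PowerSeries.coeff_trunc, if_pos (by omega), if_pos (by omega)]
  rw [map_sub] at h
  exact h

theorem convSeries_one (Z : ConvAlg H A) (hZ : Z 1 = 0) :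
    convSeries 𝒜 (fun k => (1 : PowerSeries ℂ).coeff k) Z hZ = 1 := by
  refine conv_ext fun x => ?_
  obtain ⟨N, hN⟩ := exists_convSeries_eq_aeval_trunc 𝒜 1 Z hZ x
  -- The order must be positive: truncating `1` at order `0` gives `0`.
  rw [hN (N + 1) (Nat.le_succ N), PowerSeries.trunc_one, map_one]

theorem convSeries_pow (p : PowerSeries ℂ) (Z : ConvAlg H A) (hZ : Z 1 = 0) (m : ℕ) :
    convSeries 𝒜 (fun k => (p ^ m).coeff k) Z hZ =
      convSeries 𝒜 (fun k => p.coeff k) Z hZ ^ m := by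
  induction m with
  | zero => simp only [pow_zero, convSeries_one]
  | succ m ih => simp only [pow_succ, convSeries_mul, ih]

theorem toLin_charExp (Z : infChar H A) :
    toLin (charExp 𝒜 Z) = convSeries 𝒜 (fun k => (k.factorial : ℂ)⁻¹) (Z : ConvAlg H A)
      (IsInf.map_one Z.2) := rfl

/-- This is `exp(Z)^m = exp(mZ)`, transported from the formal identity that the `m`-th power of the
exponential series is its rescaling by `m`. At fixed `x` the result is polynomial in `m`. -/
theorem charExp_pow_apply (Z : infChar H A) (m : ℕ) (x : H) {N : ℕ}
    (hN : ∀ k, N ≤ k → ((Z : ConvAlg H A) ^ k) x = 0) :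
    (charExp 𝒜 Z ^ m) x =
      ∑ k ∈ Finset.range N, ((m : ℂ) ^ k * (k.factorial : ℂ)⁻¹) • ((Z : ConvAlg H A) ^ k) x := by
  have h1 : (charExp 𝒜 Z ^ m) x = toLin (charExp 𝒜 Z ^ m) x := rfl
  have h2 : (fun k : ℕ => (k.factorial : ℂ)⁻¹) = fun k => (PowerSeries.exp ℂ).coeff k := by
    ext k; simp [PowerSeries.coeff_exp]
  have h3 : (fun k : ℕ => (PowerSeries.exp ℂ ^ m).coeff k) =
      fun k : ℕ => (m : ℂ) ^ k * (k.factorial : ℂ)⁻¹ := by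
    ext k; simp [PowerSeries.exp_pow_eq_rescale_exp, PowerSeries.coeff_rescale,
      PowerSeries.coeff_exp]
  rw [h1, toLin_pow, toLin_charExp]
  simp only [h2]
  rw [← convSeries_pow]
  simp only [h3]
  exact series_eq_sum _ _ x N hN

/-- The logarithm is the linear coefficient of the polynomial interpolating `m ↦ φ^m(x)`. For `φ =
exp Z` another such polynomial has coefficients `Z^k(x) / k!`. The two agree at all natural numbers,
an infinite subset of the domain `A`, so they coincide and the linear coefficient is `Z(x)`. -/
theorem charLog_charExp [IsDomain A] (Z : infChar H A) : charLog 𝒜 (charExp 𝒜 Z) = Z := by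
  refine Subtype.ext (conv_ext fun x => ?_)
  obtain ⟨N, hN⟩ := exists_bound (A := A) 𝒜 x
  have hN' := hN Z (IsInf.map_one Z.2)
  obtain ⟨P, hP, hP1⟩ := exists_log_poly 𝒜 (charExp 𝒜 Z)
    (toLin_sub_one_apply_one (charExp 𝒜 Z)) x
  set Q : Polynomial A := ∑ k ∈ Finset.range N,
    Polynomial.monomial k ((k.factorial : ℂ)⁻¹ • ((Z : ConvAlg H A) ^ k) x) with hQ
  have hQ1 : Q.coeff 1 = (Z : ConvAlg H A) x := by
    simp only [hQ, Polynomial.finsetSum_coeff, Polynomial.coeff_monomial, Finset.sum_ite_eq',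
      Finset.mem_range]
    split_ifs with h
    · simp
    -- If `N ≤ 1` the linear term is missing from `Q`, but then `Z(x)` is itself zero.
    · rw [← hN' 1 (not_lt.1 h), pow_one]
  have hinj : Function.Injective (fun m : ℕ => (m : A)) := fun m n h => by
    have h' : algebraMap ℂ A (m : ℂ) = algebraMap ℂ A (n : ℂ) := by
      rw [map_natCast, map_natCast]; exact h
    exact Nat.cast_injective ((algebraMap ℂ A).injective h')
  have hPQ : P = Q := by
    refine Polynomial.eq_of_infinite_eval_eq _ _ ((Set.infinite_range_of_injective hinj).mono ?_)
    rintro _ ⟨m, rfl⟩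
    show P.eval (m : A) = Q.eval (m : A)
    rw [hP, charExp_pow_apply 𝒜 Z m x hN', hQ, Polynomial.eval_finsetSum]
    refine Finset.sum_congr rfl fun k _ => ?_
    rw [Polynomial.eval_monomial, Algebra.smul_def, Algebra.smul_def, map_mul, map_pow,
      map_natCast]
    ring
  rw [← hQ1, ← hPQ, hP1]
  rfl

end ConvSeries

/-! ### The degree derivation and multiplication of values by a scalar of `A`. -/

section Coderivation

variable {H A : Type*} [CommRing H] [HopfAlgebra ℂ H] [CommRing A] [Algebra ℂ A]
  (𝒜 : ℕ → Submodule ℂ H) [GradedAlgebra 𝒜]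

theorem compDeg_apply (F : ConvAlg H A) (x : H) : compDeg 𝒜 F x = F (degMap 𝒜 x) := rfl

theorem mulValue_apply (a : A) (F : ConvAlg H A) (x : H) : mulValue a F x = a * F x := rfl

theorem mulValue_add (a : A) (F G : ConvAlg H A) :
    mulValue a (F + G) = mulValue a F + mulValue a G :=
  conv_ext fun _ => mul_add _ _ _

/-- Commutativity of `A` lets a factor on the values pass through the convolution from either side;
proving this on arbitrary tensors covers the coproduct, which need not be a pure tensor. -/
theorem box_mulValue_left (a : A) (F G : ConvAlg H A) (t : H ⊗[ℂ] H) :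
    box (mulValue a F) G t = a * box F G t := by
  induction t with
  | zero => simp
  | tmul x y => rw [box_tmul, box_tmul, mulValue_apply, mul_assoc]
  | add s t hs ht => rw [map_add, map_add, hs, ht, mul_add]

theorem box_mulValue_right (a : A) (F G : ConvAlg H A) (t : H ⊗[ℂ] H) :
    box F (mulValue a G) t = a * box F G t := by
  induction t with
  | zero => simp
  | tmul x y => rw [box_tmul, box_tmul, mulValue_apply, mul_left_comm]
  | add s t hs ht => rw [map_add, map_add, hs, ht, mul_add]

theorem mulValue_mul (a : A) (F G : ConvAlg H A) : mulValue a F * G = mulValue a (F * G) :=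
  conv_ext fun _ => box_mulValue_left a F G _

theorem mul_mulValue (a : A) (F G : ConvAlg H A) : F * mulValue a G = mulValue a (F * G) :=
  conv_ext fun _ => box_mulValue_right a F G _

/-- The degree map is a coderivation, so that `F ↦ F ∘ Y` is a derivation of the convolution. -/
theorem compDeg_mul [ConnectedGraded 𝒜] (F G : ConvAlg H A) :
    compDeg 𝒜 (F * G) = compDeg 𝒜 F * G + F * compDeg 𝒜 G := by
  -- The coproduct of a degree `n` element lies in the sum of the `H_i ⊗ H_j` with `i + j = n`,
  -- where multiplication by `n` is `Y ⊗ 1 + 1 ⊗ Y`.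
  have hom : ∀ n, ∀ x ∈ 𝒜 n, ∀ t : H ⊗[ℂ] H, t = Coalgebra.comul (R := ℂ) x →
      (n : ℂ) • box F G t = box (compDeg 𝒜 F) G t + box F (compDeg 𝒜 G) t := by
    rintro n x hx t rfl
    refine Submodule.iSup_induction' (motive := fun t _ =>
      (n : ℂ) • box F G t = box (compDeg 𝒜 F) G t + box F (compDeg 𝒜 G) t)
      _ ?_ ?_ ?_ (ConnectedGraded.comul n x hx)
    · intro p t ht
      by_cases hp : p ∈ Finset.HasAntidiagonal.antidiagonal n
      · simp only [hp, iSup_pos] at ht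
        obtain ⟨u, rfl⟩ := ht
        obtain rfl := Finset.HasAntidiagonal.mem_antidiagonal.1 hp
        induction u with
        | zero => simp
        | add a b ha hb =>
          simp only [map_add, smul_add, ha, hb]
          abel
        | tmul a b =>
          simp only [TensorProduct.mapIncl, TensorProduct.map_tmul, Submodule.subtype_apply,
            box_tmul, compDeg_apply, degMap_apply 𝒜 _ _ a.2, degMap_apply 𝒜 _ _ b.2, map_smul,
            smul_mul_assoc, mul_smul_comm, ← add_smul, Nat.cast_add]
      · simp only [hp, not_false_eq_true, iSup_neg] at ht
        rw [(Submodule.mem_bot ℂ).1 ht]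
        simp
    · simp
    · intro a b _ _ ha hb
      simp only [map_add, smul_add, ha, hb]
      abel
  refine conv_ext fun x => ?_
  induction x using DirectSum.Decomposition.inductionOn 𝒜 with
  | zero => simp
  | add a b ha hb => rw [map_add, map_add, ha, hb]
  | @homogeneous n x =>
    rw [compDeg_apply, degMap_apply 𝒜 n x x.2, map_smul, conv_add_apply, conv_mul_apply,
      conv_mul_apply, conv_mul_apply]
    exact hom n x x.2 _ rfl

end Coderivation

/-! ### Differentiation of curves in the convolution algebra. -/

section ConvCalculus

variable {H : Type*} [CommRing H] [HopfAlgebra ℂ H]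
  {𝕜 : Type*} [NontriviallyNormedField 𝕜] [NormedAlgebra 𝕜 ℂ]

/-- The derivative of a curve of linear maps that is differentiable at each element is linear. -/
theorem exists_hasConvDerivAt {F : 𝕜 → ConvAlg H Laurent} {t : 𝕜}
    (h : ∀ x, ∃ a, HasLaurentDerivAt (fun u => F u x) a t) : ∃ F', HasConvDerivAt F F' t := by
  choose D hD using h
  refine ⟨toConv ⟨⟨D, fun x y => ?_⟩, fun c x => ?_⟩, hD⟩
  · refine (hD (x + y)).unique ?_
    simpa only [map_add] using (hD x).add (hD y)
  · refine (hD (c • x)).unique ?_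
    simpa only [map_smul, RingHom.id_apply] using (hD x).const_smul c

namespace HasConvDerivAt

variable {F G : 𝕜 → ConvAlg H Laurent} {F' G' : ConvAlg H Laurent} {t : 𝕜}

theorem hasConvDerivAt_convDeriv (h : HasConvDerivAt F F' t) :
    HasConvDerivAt F (convDeriv F t) t := by
  have hex : ∃ F', HasConvDerivAt F F' t := ⟨F', h⟩
  rw [convDeriv, dif_pos hex]
  exact hex.choose_spec

theorem convDeriv_eq (h : HasConvDerivAt F F' t) : convDeriv F t = F' :=
  h.hasConvDerivAt_convDeriv.unique h

theorem congr_of_eventuallyEq (h : HasConvDerivAt F F' t) (hG : G =ᶠ[nhds t] F) :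
    HasConvDerivAt G F' t := fun x =>
  (h x).congr_of_eventuallyEq (hG.fun_comp fun K : ConvAlg H Laurent => K x)

theorem const (F : ConvAlg H Laurent) (t : 𝕜) : HasConvDerivAt (fun _ : 𝕜 => F) 0 t := fun x =>
  HasLaurentDerivAt.const (F x) t

/-- Each value of the convolution is a finite sum of products over the coproduct, so the Leibniz
rule for Laurent series extends by additivity from pure tensors. -/
theorem mul (hF : HasConvDerivAt F F' t) (hG : HasConvDerivAt G G' t) :
    HasConvDerivAt (fun u => F u * G u) (F' * G t + F t * G') t := by
  have h : ∀ z : H ⊗[ℂ] H, HasLaurentDerivAt (fun u => box (F u) (G u) z)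
      (box F' (G t) z + box (F t) G' z) t := by
    intro z
    induction z with
    | zero => simpa using HasLaurentDerivAt.const (0 : Laurent) t
    | tmul x y => simpa only [box_tmul] using (hF x).mul (hG y)
    | add a b ha hb =>
      simp only [map_add]
      rw [add_add_add_comm]
      exact ha.add hb
  exact fun x => h (Coalgebra.comul (R := ℂ) x)

theorem compDeg (𝒜 : ℕ → Submodule ℂ H) [GradedAlgebra 𝒜] (hF : HasConvDerivAt F F' t) :
    HasConvDerivAt (fun u => compDeg 𝒜 (F u)) (LaxFlow.compDeg 𝒜 F') t := fun x =>
  hF (degMap 𝒜 x)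

theorem mulValue (a : Laurent) (hF : HasConvDerivAt F F' t) :
    HasConvDerivAt (fun u => mulValue a (F u)) (LaxFlow.mulValue a F') t := fun x =>
  (hF x).const_mul a

end HasConvDerivAt

/-- The derivative of the convolution power `Z ↦ Z^{⋆ k}` at `Z` in the direction `W`. -/
noncomputable def powDeriv (Z W : ConvAlg H Laurent) : ℕ → ConvAlg H Laurent
  | 0 => 0
  | k + 1 => powDeriv Z W k * Z + Z ^ k * W

theorem HasConvDerivAt.pow {F : 𝕜 → ConvAlg H Laurent} {F' : ConvAlg H Laurent} {t : 𝕜}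
    (hF : HasConvDerivAt F F' t) (k : ℕ) :
    HasConvDerivAt (fun u => F u ^ k) (powDeriv (F t) F' k) t := by
  induction k with
  | zero => simpa only [pow_zero, powDeriv] using HasConvDerivAt.const 1 t
  | succ k ih => simpa only [pow_succ, powDeriv] using ih.mul hF

variable (𝒜 : ℕ → Submodule ℂ H) [GradedAlgebra 𝒜]

/-! ### The differential of the exponential. -/

section Exp

variable [ConnectedGraded 𝒜]

/-- Along any differentiable curve of infinitesimal characters, the derivative of the exponential
is a finite sum at each element, depending only on the point and the tangent vector. -/
theorem hasLaurentDerivAt_charExp {Z : 𝕜 → infChar H Laurent} {W : ConvAlg H Laurent} {t : 𝕜}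
    (hZ : HasConvDerivAt (fun u => (Z u : ConvAlg H Laurent)) W t) {x : H} {N : ℕ}
    (hN : ∀ Z : ConvAlg H Laurent, Z 1 = 0 → ∀ k, N ≤ k → (Z ^ k) x = 0) :
    HasLaurentDerivAt (fun u => toLin (charExp 𝒜 (Z u)) x)
      (∑ k ∈ Finset.range N, (k.factorial : ℂ)⁻¹ • powDeriv (Z t : ConvAlg H Laurent) W k x) t := by
  refine (HasLaurentDerivAt.sum (Finset.range N) fun k _ =>
    (hZ.pow k x).const_smul ((k.factorial : ℂ)⁻¹)).congr_of_eventuallyEq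
    (Filter.Eventually.of_forall fun u => ?_)
  exact series_eq_sum _ _ x N (hN (Z u) (IsInf.map_one (Z u).2))

theorem hasConvDerivAt_line (Z W : ConvAlg H Laurent) :
    HasConvDerivAt (fun u : ℂ => Z + u • W) W 0 := fun x => by
  have h : HasLaurentDerivAt (fun u : ℂ => u • W x) (W x) 0 := by
    obtain ⟨N, hN⟩ := (W x).exists_bound_coeff
    refine ⟨⟨N, Filter.Eventually.of_forall fun u n hn => ?_⟩, fun n => ?_⟩
    · rw [Laurent.coeff_smul, hN n hn, mul_zero]
    · simpa [Laurent.coeff_smul] using (hasDerivAt_id (0 : ℂ)).mul_const ((W x).coeff n)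
  simpa using (HasLaurentDerivAt.const (Z x) (0 : ℂ)).add h

/-- `convDeriv` takes the default value `0` when no derivative exists, so existence has to be proved
before `dexp` can be used as a derivative. -/
theorem hasConvDerivAt_expCurve (Z W : infChar H Laurent) :
    HasConvDerivAt (expCurve 𝒜 Z W) (dexp 𝒜 Z W) 0 := by
  obtain ⟨D, hD⟩ : ∃ D, HasConvDerivAt (expCurve 𝒜 Z W) D 0 := exists_hasConvDerivAt fun x => by
    obtain ⟨N, hN⟩ := exists_bound (A := Laurent) 𝒜 x
    exact ⟨_, hasLaurentDerivAt_charExp 𝒜 (Z := fun u : ℂ => Z + u • W)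
      (hasConvDerivAt_line (Z : ConvAlg H Laurent) W) hN⟩
  exact hD.hasConvDerivAt_convDeriv

/-- Chain rule for the exponential. -/
theorem HasConvDerivAt.charExp {Z : 𝕜 → infChar H Laurent} {W : infChar H Laurent} {t : 𝕜}
    (hZ : HasConvDerivAt (fun u => (Z u : ConvAlg H Laurent)) W t) :
    HasConvDerivAt (fun u => toLin (charExp 𝒜 (Z u))) (dexp 𝒜 (Z t) W) t := fun x => by
  obtain ⟨N, hN⟩ := exists_bound (A := Laurent) 𝒜 x
  have h := hasLaurentDerivAt_charExp 𝒜 (Z := fun u : ℂ => Z t + u • W)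
    (hasConvDerivAt_line (Z t : ConvAlg H Laurent) W) hN
  -- The straight line through `Z t` and the given curve share their point and tangent vector, hence
  -- the same finite sum of `powDeriv` terms; on the line that sum is `dexp`.
  rw [(hasConvDerivAt_expCurve 𝒜 (Z t) W x).unique h]
  simpa using hasLaurentDerivAt_charExp 𝒜 hZ hN

end Exp

/-! ### Inverses of curves of characters, and the variation of the beta character. -/

theorem toLin_inv_mul (φ : CharGroup H Laurent) : toLin φ⁻¹ * toLin φ = 1 := by
  rw [← toLin_mul, inv_mul_cancel, toLin_one]

theorem toLin_mul_inv (φ : CharGroup H Laurent) : toLin φ * toLin φ⁻¹ = 1 := by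
  rw [← toLin_mul, mul_inv_cancel, toLin_one]

/-- The derivative of the inverse of a curve of characters. -/
theorem HasConvDerivAt.inv {φ : 𝕜 → CharGroup H Laurent} {D : ConvAlg H Laurent} {t : 𝕜}
    (h : HasConvDerivAt (fun u => toLin (φ u)) D t) :
    HasConvDerivAt (fun u => toLin (φ u)⁻¹) (-(toLin (φ t)⁻¹ * D * toLin (φ t)⁻¹)) t := by
  -- Inversion is composition with the antipode, so differentiability of the inverse is immediate;
  -- its value in convolution form then follows by differentiating `φ⁻¹ ⋆ φ = 1`.
  have hS : HasConvDerivAt (fun u => toLin (φ u)⁻¹)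
      (toConv (D.ofConv ∘ₗ HopfAlgebra.antipode ℂ (A := H))) t := fun x =>
    h (HopfAlgebra.antipode ℂ x)
  have h0 := (hS.mul h).unique
    ((HasConvDerivAt.const 1 t).congr_of_eventuallyEq
      (Filter.Eventually.of_forall fun u => toLin_inv_mul (φ u)))
  convert hS using 1
  rw [← sub_eq_zero, ← neg_eq_zero]
  have h1 := congrArg (· * toLin (φ t)⁻¹) h0
  simp only [add_mul, mul_assoc, toLin_mul_inv, mul_one, zero_mul] at h1
  rw [← h1]
  simp only [mul_assoc]
  abel

/-- On degree `n` the factor `e^{tnλ}` has derivative `nλ` at `0`; the `n` is absorbed by `Y` and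
the `λ` multiplies the values. -/
theorem hasConvDerivAt_scaleChar (φ : CharGroup H Laurent) :
    HasConvDerivAt (fun t => toLin (scaleChar 𝒜 φ t)) (mulValue lam (compDeg 𝒜 (toLin φ))) 0 := by
  intro x
  induction x using DirectSum.Decomposition.inductionOn 𝒜 with
  | zero => simpa using HasLaurentDerivAt.const (0 : Laurent) (0 : ℂ)
  | add a b ha hb => simpa only [map_add] using ha.add hb
  | @homogeneous n x =>
    have h := (hasLaurentDerivAt_expLam (n : ℂ)).mul_const (φ x)
    have e : mulValue lam (compDeg 𝒜 (toLin φ)) (x : H) = (n : ℂ) • lam * φ x := by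
      rw [mulValue_apply, compDeg_apply, degMap_apply 𝒜 n x x.2, map_smul, mul_smul_comm,
        smul_mul_assoc]
      rfl
    rw [e]
    exact h.congr_of_eventuallyEq (Filter.Eventually.of_forall fun t =>
      rescaleLin_apply 𝒜 φ (fun n => expLam (t * n)) n x x.2)

theorem hasConvDerivAt_betaCurve (φ : CharGroup H Laurent) :
    HasConvDerivAt (betaCurve 𝒜 φ)
      (mulValue lam (toLin φ⁻¹ * compDeg 𝒜 (toLin φ))) 0 := by
  have h := (HasConvDerivAt.const (toLin φ⁻¹) (0 : ℂ)).mul (hasConvDerivAt_scaleChar 𝒜 φ)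
  rw [zero_mul, zero_add, mul_mulValue] at h
  exact h

theorem betaChar_eq (φ : CharGroup H Laurent) :
    betaChar 𝒜 φ = mulValue lam (toLin φ⁻¹ * compDeg 𝒜 (toLin φ)) :=
  (hasConvDerivAt_betaCurve 𝒜 φ).convDeriv_eq

/-- The variation of the beta character along a differentiable curve of characters. -/
theorem HasConvDerivAt.betaChar [ConnectedGraded 𝒜] {φ : 𝕜 → CharGroup H Laurent}
    {D : ConvAlg H Laurent} {t : 𝕜} (h : HasConvDerivAt (fun u => toLin (φ u)) D t) :
    HasConvDerivAt (fun u => betaChar 𝒜 (φ u))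
      (⁅LaxFlow.betaChar 𝒜 (φ t), toLin (φ t)⁻¹ * D⁆ +
        LaxFlow.mulValue lam (LaxFlow.compDeg 𝒜 (toLin (φ t)⁻¹ * D))) t := by
  simp only [betaChar_eq]
  convert (h.inv.mul (h.compDeg 𝒜)).mulValue lam using 1
  set p := toLin (φ t)
  set q := toLin (φ t)⁻¹
  have hqp : q * p = 1 := toLin_inv_mul (φ t)
  have hpq : p * q = 1 := toLin_mul_inv (φ t)
  -- Writing `D = p * (q * D)` before applying the derivation yields one half of the bracket and the
  -- extra term; the other half comes from the derivative of the inverse.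
  have hD : LaxFlow.compDeg 𝒜 D =
      LaxFlow.compDeg 𝒜 p * (q * D) + p * LaxFlow.compDeg 𝒜 (q * D) := by
    rw [← compDeg_mul, ← mul_assoc, hpq, one_mul]
  rw [hD, Ring.lie_def, mulValue_mul, mul_mulValue, mulValue_add, mul_add, mulValue_add,
    ← mul_assoc q p, hqp, one_mul]
  have hneg : LaxFlow.mulValue lam (-(q * D * q) * LaxFlow.compDeg 𝒜 p) =
      -LaxFlow.mulValue lam (q * D * (q * LaxFlow.compDeg 𝒜 p)) := by
    rw [neg_mul, mul_assoc (q * D)]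
    exact conv_ext fun _ => mul_neg _ _
  rw [hneg, mul_assoc q (LaxFlow.compDeg 𝒜 p)]
  abel

end ConvCalculus

end LaxFlow
-- The Lax flow.
theorem theorem6p8 {H : Type*} [CommRing H] [HopfAlgebra ℂ H]
    (𝒜 : ℕ → Submodule ℂ H) [GradedAlgebra 𝒜] [LaxFlow.ConnectedGraded 𝒜]
    (φ₀ : LaxFlow.CharGroup H LaxFlow.Laurent) (hφ₀ : LaxFlow.IsLocal 𝒜 φ₀)
    (f : LaxFlow.infChar H LaxFlow.Laurent → LaxFlow.infChar H LaxFlow.Laurent)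
    (hf : LaxFlow.AdCovariant f)
    (hcomm : ⁅f (LaxFlow.charLog 𝒜 φ₀), LaxFlow.charLog 𝒜 φ₀⁆ = 0)
    (I : Set ℝ) (hIopen : IsOpen I) (hIconn : I.OrdConnected) (hI0 : (0 : ℝ) ∈ I)
    (ψ M : ℝ → LaxFlow.infChar H LaxFlow.Laurent)
    (hM : ∀ s ∈ I, M s = (1 / 2 : ℂ) • LaxFlow.rMatrix (f (ψ s)))
    (hLax : ∀ s ∈ I, LaxFlow.HasConvDerivAt
      (fun u : ℝ => (ψ u : LaxFlow.ConvAlg H LaxFlow.Laurent))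
      (⁅ψ s, M s⁆ : LaxFlow.infChar H LaxFlow.Laurent) s)
    (hψ0 : ψ 0 = LaxFlow.charLog 𝒜 φ₀)
    (φ : ℝ → LaxFlow.CharGroup H LaxFlow.Laurent)
    (hφ : ∀ s ∈ I, φ s = LaxFlow.charExp 𝒜 (ψ s))
    (X : ℝ → LaxFlow.ConvAlg H LaxFlow.Laurent)
    (hX : ∀ s ∈ I, X s = LaxFlow.toLin (φ s)⁻¹ *
      LaxFlow.dexp 𝒜 (LaxFlow.charLog 𝒜 (φ s)) ⁅LaxFlow.charLog 𝒜 (φ s), M s⁆) :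
    ∀ s ∈ I,
      LaxFlow.HasConvDerivAt (LaxFlow.betaCurve 𝒜 (φ s)) (LaxFlow.betaChar 𝒜 (φ s)) 0 ∧
      LaxFlow.HasConvDerivAt
        (LaxFlow.expCurve 𝒜 (LaxFlow.charLog 𝒜 (φ s)) ⁅LaxFlow.charLog 𝒜 (φ s), M s⁆)
        (LaxFlow.dexp 𝒜 (LaxFlow.charLog 𝒜 (φ s)) ⁅LaxFlow.charLog 𝒜 (φ s), M s⁆) 0 ∧
      LaxFlow.HasConvDerivAt (fun u : ℝ => LaxFlow.betaChar 𝒜 (φ u))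
        (⁅LaxFlow.betaChar 𝒜 (φ s), X s⁆ +
          LaxFlow.mulValue LaxFlow.lam (LaxFlow.compDeg 𝒜 (X s))) s := by
  intro s hs
  -- The exponential formula is known only on `I`; openness makes it hold near `s`, which is enough
  -- for derivatives.
  have hev : ∀ᶠ u in nhds s, φ u = LaxFlow.charExp 𝒜 (ψ u) := by
    filter_upwards [hIopen.mem_nhds hs] with u hu using hφ u hu
  have hlog : LaxFlow.charLog 𝒜 (φ s) = ψ s := by rw [hφ s hs, LaxFlow.charLog_charExp]
  refine ⟨(LaxFlow.hasConvDerivAt_betaCurve 𝒜 (φ s)).hasConvDerivAt_convDeriv,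
    LaxFlow.hasConvDerivAt_expCurve 𝒜 _ _, ?_⟩
  -- The Lax equation supplies the tangent vector `[ψ, M]` for the chain rule.
  have h := (LaxFlow.HasConvDerivAt.charExp 𝒜 (hLax s hs)).congr_of_eventuallyEq
    (hev.mono fun u hu => congrArg LaxFlow.toLin hu)
  rw [hX s hs, hlog]
  exact h.betaChar 𝒜
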